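/- Let $p$ be a prime. For a presentation $\langle X\mid R\rangle$ with $X$ finite and $R\subseteq F(X)$ finite or infinite, put $\mathrm{def}_p(X,R)=|X|-\sum_{r\in R}p^{-\nu_p(r)}$, where $\nu_p(r)$ is the largest $k\ge 0$ such that $r=w^{p^k}$ for some $w\in F(X)$ (an identity relator contributes $0$, and $\mathrm{def}_p=-\infty$ if the sum diverges). For a group $\Gamma$ let $d_p(\Gamma)=\dim_{\mathbb F_p}H_1(\Gamma;\mathbb F_p)$, and call $\Gamma$ strongly Golod–Shafarevich (for $p$) if $d_p(\Gamma)\ge 2$ and $\Gamma$ has a finite presentation $\langle Y\mid S\rangle$ with $$|Y|-|S|+\frac{d_p(\Gamma)^2}{4}-d_p(\Gamma)>0.$$ Theorem. Let $G$ be a finitely presented group which is a Puchta group for $p$, that is, $G$ has a presentation $\langle X\mid R\rangle$ with $X$ finite and $\mathrm{def}_p(X,R)>1$. Then $G$ has a normal subgroup $H$ of index $p^N$, for some integer $N\ge 1$, such that $H$ is strongly Golod–Shafarevich for the same prime $p$. -/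

import Mathlib

open scoped ENNReal

/-- `(n, R)` presents `G`: the group `⟨x₁, …, xₙ | R⟩` is isomorphic to `G`.  The set `R` of
relators is an arbitrary, finite or infinite, subset of the free group of rank `n`. -/
def IsPresentationOf {n : ℕ} (R : Set (FreeGroup (Fin n))) (G : Type*) [Group G] : Prop :=
  Nonempty (PresentedGroup R ≃* G)

/-- `ν_p(r)`: the largest `k` such that `r` is a `p ^ k`-th power in the free group.  It is `⊤`
exactly when `r` is a `p ^ k`-th power for arbitrarily large `k`, that is for the identity. -/
noncomputable def relatorNu (p : ℕ) {n : ℕ} (r : FreeGroup (Fin n)) : ℕ∞ :=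
  ⨆ (k : ℕ) (_ : ∃ w : FreeGroup (Fin n), w ^ p ^ k = r), (k : ℕ∞)

/-- `p ^ (-ν_p(r))`, with the value `p ^ (-∞) = 0` for the identity. -/
noncomputable def relatorWeight (p : ℕ) {n : ℕ} (r : FreeGroup (Fin n)) : ℝ≥0∞ :=
  if relatorNu p r = ⊤ then 0 else ((p : ℝ≥0∞) ^ (relatorNu p r).toNat)⁻¹

/-- The `p`-deficiency `n - ∑_{r ∈ R} p ^ (-ν_p(r))` of the presentation `⟨x₁, …, xₙ | R⟩`;
it is `-∞` when the sum diverges. -/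
noncomputable def pDeficiency (p : ℕ) {n : ℕ} (R : Set (FreeGroup (Fin n))) : EReal :=
  (n : EReal) - ((∑' r : R, relatorWeight p r.1 : ℝ≥0∞) : EReal)

/-- `G` has a presentation, on finitely many generators, of `p`-deficiency greater than one
(a Puchta presentation, for the prime `p`). -/
def IsPuchtaGroup (p : ℕ) (G : Type*) [Group G] : Prop :=
  ∃ (n : ℕ) (R : Set (FreeGroup (Fin n))), IsPresentationOf R G ∧ 1 < pDeficiency p R

/-- The deficiency `n - |R|` of a finite presentation `⟨x₁, …, xₙ | R⟩`. -/
def deficiency {n : ℕ} (R : Finset (FreeGroup (Fin n))) : ℤ :=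
  (n : ℤ) - (R.card : ℤ)

/-- The `p`-rank `d_p(G)`: the dimension over `𝔽_p` of `H₁(G; 𝔽_p)`.  The field is lifted to the
universe of `G`, as Mathlib's group homology requires. -/
noncomputable def pRank.{u} (p : ℕ) (G : Type u) [Group G] : ℕ :=
  Module.finrank (ULift.{u} (ZMod p))
    (groupHomology.H1 (Rep.trivial (ULift.{u} (ZMod p)) G (ULift.{u} (ZMod p))))

/-- `G` is strongly Golod–Shafarevich for the prime `p`: `d_p(G) ≥ 2`, and `G` has a finite
presentation with `def + d_p(G)² / 4 - d_p(G) > 0`. -/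
def IsStronglyGolodShafarevich (p : ℕ) (G : Type*) [Group G] : Prop :=
  2 ≤ pRank p G ∧
    ∃ (n : ℕ) (R : Finset (FreeGroup (Fin n))),
      IsPresentationOf (R : Set (FreeGroup (Fin n))) G ∧
        0 < (deficiency R : ℝ) + (pRank p G : ℝ) ^ 2 / 4 - (pRank p G : ℝ)

/-! Let `ε = def_p - 1 > 0` and let `H` be normal of index `m = p ^ N`. The rank `d_p(H)` is at
least `m * ε + 1`, while a finite presentation of `G` yields one of `H` whose deficiency is at least
`1 - m * C`, with `C` independent of `H`. So `d ^ 2 / 4` grows quadratically in `m` and beats the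
linear loss `d - def`; any `H` of large enough index works (`golodShafarevich_of_growth`).

The rank bound (`finrank_modPHom_ge`) is computed in `Hom(H, 𝔽_p)`. Let `K` be the preimage of `H`
in the free group. By Schreier, `Hom(K, 𝔽_p)` has dimension at least `m * (n - 1) + 1`, and `Hom(H,
𝔽_p)` is cut out of it by evaluation at the conjugates of the relators. For `r = w ^ p ^ k` these
evaluations either all vanish or `w` has order `p ^ k` modulo `K`. Since conjugation by `w` fixes
`r`, at most `m / p ^ k` of them are distinct (`ncard_conjEval_le_weight`).

Positivity of the rank also produces subgroups of arbitrarily large index, by repeatedly passing to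
the common kernel of all maps to `𝔽_p`. -/

/-- The `ZMod p`-vector space of homomorphisms `G → 𝔽_p`. -/
abbrev ModPHom (p : ℕ) (G : Type*) [Group G] : Type _ := Additive G →+ ZMod p

/-! ### Homomorphisms to `𝔽_p`. -/

namespace ModPHom

variable {p : ℕ} {G : Type*} [Group G]

theorem map_mul' (f : ModPHom p G) (a b : G) :
    f (Additive.ofMul (a * b)) = f (Additive.ofMul a) + f (Additive.ofMul b) := by
  rw [ofMul_mul, map_add]

theorem map_one' (f : ModPHom p G) : f (Additive.ofMul (1 : G)) = 0 := by
  rw [ofMul_one, map_zero]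

theorem map_inv' (f : ModPHom p G) (a : G) :
    f (Additive.ofMul a⁻¹) = - f (Additive.ofMul a) := by
  rw [ofMul_inv, map_neg]

theorem map_pow' (f : ModPHom p G) (a : G) (k : ℕ) :
    f (Additive.ofMul (a ^ k)) = k • f (Additive.ofMul a) := by
  rw [ofMul_pow, map_nsmul]

theorem map_conj (f : ModPHom p G) (a b : G) :
    f (Additive.ofMul (a * b * a⁻¹)) = f (Additive.ofMul b) := by
  rw [map_mul', map_mul', map_inv']; ring

/-- The elements of `G` killed by `f`. -/
def kernel (f : ModPHom p G) : Subgroup G where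
  carrier := {g | f (Additive.ofMul g) = 0}
  mul_mem' {a b} ha hb := by
    simp only [Set.mem_ofPred_eq] at *
    rw [map_mul', ha, hb, add_zero]
  one_mem' := map_one' f
  inv_mem' {a} ha := by
    simp only [Set.mem_ofPred_eq] at *
    rw [map_inv', ha, neg_zero]

instance [Fact p.Prime] [Group.FG G] : FiniteDimensional (ZMod p) (ModPHom p G) := by
  obtain ⟨S, hS⟩ := Group.FG.out (G := G)
  let Φ : ModPHom p G →ₗ[ZMod p] (S → ZMod p) :=
    { toFun := fun f s => f (Additive.ofMul s.1)
      map_add' := fun _ _ => rfl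
      map_smul' := fun _ _ => rfl }
  refine FiniteDimensional.of_injective Φ ?_
  rw [← LinearMap.ker_eq_bot, LinearMap.ker_eq_bot']
  intro f hf
  have h : Subgroup.closure (S : Set G) ≤ f.kernel := by
    rw [Subgroup.closure_le]
    intro s hs
    exact congrFun hf ⟨s, hs⟩
  rw [hS] at h
  ext g
  exact h (Subgroup.mem_top g)

end ModPHom

/-! ### Schreier's bound through crossed homomorphisms. -/

section CrossedHom

variable (p : ℕ) {n : ℕ} (K : Subgroup (FreeGroup (Fin n)))

/-- The crossed homomorphisms from the free group `F` to the functions on `F ⧸ K`. -/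
def crossedHom : Submodule (ZMod p)
    (FreeGroup (Fin n) → (FreeGroup (Fin n) ⧸ K) → ZMod p) where
  carrier := {c | ∀ x y q, c (x * y) q = c x q + c y (x⁻¹ • q)}
  add_mem' {a b} ha hb x y q := by
    simp only [Pi.add_apply, ha x y q, hb x y q]; ring
  zero_mem' x y q := by simp
  smul_mem' r a ha x y q := by
    simp only [Pi.smul_apply, ha x y q, smul_add]

variable {p K}

/-- Translation of functions on `F ⧸ K`, as an action by automorphisms. -/
def translationAut (p : ℕ) (K : Subgroup (FreeGroup (Fin n))) :
    FreeGroup (Fin n) →* MulAut (Multiplicative ((FreeGroup (Fin n) ⧸ K) → ZMod p)) where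
  toFun g :=
    { toFun := fun h => Multiplicative.ofAdd fun q => h.toAdd (g⁻¹ • q)
      invFun := fun h => Multiplicative.ofAdd fun q => h.toAdd (g • q)
      left_inv := fun h => by ext q; simp
      right_inv := fun h => by ext q; simp
      map_mul' := fun _ _ => rfl }
  map_one' := by ext h q; simp
  map_mul' a b := by ext h q; simp [mul_smul]

/-- A crossed homomorphism is the left component of a section into the semidirect product, and
freeness supplies such a section with prescribed values. -/
theorem crossedHom.exists_extend (a : Fin n → (FreeGroup (Fin n) ⧸ K) → ZMod p) :
    ∃ c ∈ crossedHom p K, ∀ i, c (FreeGroup.of i) = a i := by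
  let Λ : FreeGroup (Fin n) →*
      Multiplicative ((FreeGroup (Fin n) ⧸ K) → ZMod p) ⋊[translationAut p K]
        FreeGroup (Fin n) :=
    FreeGroup.lift fun i => ⟨Multiplicative.ofAdd (a i), FreeGroup.of i⟩
  have hΛ : SemidirectProduct.rightHom.comp Λ = MonoidHom.id _ := by
    ext i; simp [Λ]
  have hr (x) : (Λ x).right = x := DFunLike.congr_fun hΛ x
  refine ⟨fun x => (Λ x).left.toAdd, ?_, ?_⟩
  · intro x y q
    simp only [map_mul, SemidirectProduct.mul_left, hr]
    rfl
  · intro i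
    simp [Λ]

open Classical in
/-- The lower bound in the Schreier index formula. -/
theorem schreier_le_finrank (p : ℕ) [Fact p.Prime] {n : ℕ} (K : Subgroup (FreeGroup (Fin n)))
    [K.FiniteIndex] :
    K.index * n + 1 ≤ Module.finrank (ZMod p) (ModPHom p K) + K.index := by
  let Q := FreeGroup (Fin n) ⧸ K
  let e : Q := ((1 : FreeGroup (Fin n)) : Q)
  have hfix (k : K) : (k.1⁻¹ : FreeGroup (Fin n)) • e = e := by
    change ((k.1⁻¹ * 1 : FreeGroup (Fin n)) : Q) = ((1 : FreeGroup (Fin n)) : Q)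
    rw [QuotientGroup.eq]; simp
  have : Group.FG K := Subgroup.fg_of_index_ne_zero K
  have : Finite Q := Subgroup.finite_quotient_of_finiteIndex
  have : Fintype Q := Fintype.ofFinite Q
  have hQ : Fintype.card Q = K.index := by
    rw [Subgroup.index_eq_card, Nat.card_eq_fintype_card]
  -- As in Shapiro's lemma: restriction to `K` at the base coset, plus one value for each other
  -- coset to account for principal crossed homomorphisms. The omitted base coset gives the `+ 1`.
  let Ψ : crossedHom p K →ₗ[ZMod p] ModPHom p K × ({q : Q // q ≠ e} → ZMod p) :=
    { toFun := fun c =>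
        (AddMonoidHom.mk' (fun k => c.1 k.toMul.1 e) (by
          intro a b
          have := c.2 a.toMul.1 b.toMul.1 e
          rw [hfix] at this
          simpa using this), fun q => c.1 q.1.out q.1)
      map_add' := fun _ _ => rfl
      map_smul' := fun _ _ => rfl }
  have hΨ : Function.Injective Ψ := by
    rw [← LinearMap.ker_eq_bot, LinearMap.ker_eq_bot']
    rintro ⟨c, hc⟩ h
    have h1 (k : FreeGroup (Fin n)) (hk : k ∈ K) : c k e = 0 :=
      DFunLike.congr_fun (congrArg Prod.fst h) (Additive.ofMul (⟨k, hk⟩ : K))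
    have h2 (q : Q) : c q.out q = 0 := by
      by_cases hq : q = e
      · subst hq
        apply h1
        have := QuotientGroup.out_eq' e
        rw [QuotientGroup.eq] at this
        simpa using this
      · exact congrFun (congrArg Prod.snd h) ⟨q, hq⟩
    have h3 (g : FreeGroup (Fin n)) : c g (g : Q) = 0 := by
      have hk : ((g : Q).out)⁻¹ * g ∈ K := by
        rw [← QuotientGroup.eq]; exact QuotientGroup.out_eq' _
      have := hc (g : Q).out (((g : Q).out)⁻¹ * g) (g : Q)
      rw [mul_inv_cancel_left, h2, zero_add] at this
      rw [this]
      have h4 : (((g : Q).out)⁻¹ • (g : Q)) = e := by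
        change ((((g : Q).out)⁻¹ * g : FreeGroup (Fin n)) : Q) = _
        rw [eq_comm, QuotientGroup.eq]; simpa using hk
      rw [h4]
      exact h1 _ hk
    ext g q
    obtain ⟨x, rfl⟩ := QuotientGroup.mk_surjective q
    -- The cocycle identity for `x = g * (g⁻¹ * x)` expresses `c g` through the values already shown
    -- to vanish.
    have := hc g (g⁻¹ * x) (x : Q)
    rw [mul_inv_cancel_left, h3] at this
    have h5 : (g⁻¹ • (x : Q)) = ((g⁻¹ * x : FreeGroup (Fin n)) : Q) := rfl
    rw [h5, h3, add_zero] at this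
    exact this.symm
  have hfd : FiniteDimensional (ZMod p) (crossedHom p K) := FiniteDimensional.of_injective Ψ hΨ
  let ρ : crossedHom p K →ₗ[ZMod p] (Fin n → Q → ZMod p) :=
    { toFun := fun c i => c.1 (FreeGroup.of i)
      map_add' := fun _ _ => rfl
      map_smul' := fun _ _ => rfl }
  have hρ : Function.Surjective ρ := fun a => by
    obtain ⟨c, hc, h⟩ := crossedHom.exists_extend a
    exact ⟨⟨c, hc⟩, funext h⟩
  have l1 := LinearMap.finrank_le_finrank_of_injective hΨ
  have l2 := LinearMap.finrank_le_finrank_of_surjective hρ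
  rw [Module.finrank_prod, Module.finrank_fintype_fun_eq_card, Fintype.card_subtype_compl,
    Fintype.card_subtype_eq, hQ] at l1
  have l3 : Module.finrank (ZMod p) (Fin n → Q → ZMod p) = K.index * n := by
    rw [Module.finrank_pi_fintype]
    simp [hQ, mul_comm]
  have : K.index ≠ 0 := Subgroup.FiniteIndex.index_ne_zero
  omega

end CrossedHom

/-! ### Reidemeister–Schreier rewriting for a finite presentation. -/

section Rewriting

variable {F : Type*} [Group F]

/-- The conjugates of the relators `R` by the inverses of a left transversal of `K`, as elements
of `K`. -/
def rewrittenRelators (R : Set F) (K : Subgroup F) : Set K :=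
  {k | ∃ q : F ⧸ K, ∃ r ∈ R, k.1 = q.out⁻¹ * r * q.out}

theorem normalClosure_rewrittenRelators {R : Set F} {K : Subgroup F}
    (hRK : Subgroup.normalClosure R ≤ K) :
    Subgroup.normalClosure (rewrittenRelators R K) = (Subgroup.normalClosure R).subgroupOf K := by
  apply le_antisymm
  · apply Subgroup.normalClosure_le_normal
    rintro k ⟨q, r, hr, hk⟩
    change k.1 ∈ Subgroup.normalClosure R
    rw [hk]
    have := (Subgroup.normalClosure_normal (s := R)).conj_mem r
      (Subgroup.subset_normalClosure hr) q.out⁻¹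
    simpa using this
  · have h : Subgroup.normalClosure R ≤
        (Subgroup.normalClosure (rewrittenRelators R K)).map K.subtype := by
      rw [Subgroup.normalClosure, Subgroup.closure_le]
      intro x hx
      rw [Group.mem_conjugatesOfSet_iff] at hx
      obtain ⟨r, hr, hx⟩ := hx
      obtain ⟨g, rfl⟩ := isConj_iff.1 hx
      -- With `q` the coset of `g⁻¹`, `g` factors as an element of `K` times `q.out⁻¹`, so `g * r *
      -- g⁻¹` is a `K`-conjugate of a rewritten relator.
      let q : F ⧸ K := ((g⁻¹ : F) : F ⧸ K)
      have hk : g * q.out ∈ K := by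
        have h1 : ((g⁻¹ : F) : F ⧸ K) = ((q.out : F) : F ⧸ K) :=
          (QuotientGroup.out_eq' q).symm
        rw [QuotientGroup.eq] at h1
        simpa using h1
      have hs : q.out⁻¹ * r * q.out ∈ K := by
        apply hRK
        have := (Subgroup.normalClosure_normal (s := R)).conj_mem r
          (Subgroup.subset_normalClosure hr) q.out⁻¹
        simpa using this
      let k : K := ⟨_, hk⟩
      let s : K := ⟨_, hs⟩
      have hsm : s ∈ Subgroup.normalClosure (rewrittenRelators R K) :=
        Subgroup.subset_normalClosure ⟨q, r, hr, rfl⟩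
      refine ⟨k * s * k⁻¹, Subgroup.normalClosure_normal.conj_mem s hsm k, ?_⟩
      simp only [Subgroup.subtype_apply, Subgroup.coe_mul, Subgroup.coe_inv, k, s]
      group
    intro k hk
    obtain ⟨k', hk', h'⟩ := h (Subgroup.mem_subgroupOf.1 hk)
    rwa [← Subtype.ext (show k'.1 = k.1 from h')]

theorem finite_rewrittenRelators {R : Set F} (hR : R.Finite) (K : Subgroup F) [K.FiniteIndex] :
    (rewrittenRelators R K).Finite ∧
      (rewrittenRelators R K).ncard ≤ K.index * R.ncard := by
  have : Finite (F ⧸ K) := Subgroup.finite_quotient_of_finiteIndex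
  have hsub : Subtype.val '' rewrittenRelators R K ⊆
      (fun x : (F ⧸ K) × F => x.1.out⁻¹ * x.2 * x.1.out) '' (Set.univ ×ˢ R) := by
    rintro _ ⟨k, ⟨q, r, hr, hk⟩, rfl⟩
    exact ⟨(q, r), ⟨Set.mem_univ _, hr⟩, hk.symm⟩
  have hfin : (Set.univ ×ˢ R : Set ((F ⧸ K) × F)).Finite := Set.finite_univ.prod hR
  refine ⟨((hfin.image _).subset hsub).of_finite_image Subtype.val_injective.injOn, ?_⟩
  calc (rewrittenRelators R K).ncard
      = (Subtype.val '' rewrittenRelators R K).ncard :=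
        (Set.ncard_image_of_injective _ Subtype.val_injective).symm
    _ ≤ _ := Set.ncard_le_ncard hsub (hfin.image _)
    _ ≤ _ := Set.ncard_image_le hfin
    _ = K.index * R.ncard := by rw [Set.ncard_prod, Set.ncard_univ, Subgroup.index_eq_card]

theorem normalClosure_image_mulEquiv {A B : Type*} [Group A] [Group B] (e : A ≃* B) (S : Set A) :
    Subgroup.normalClosure (e '' S) = (Subgroup.normalClosure S).map e.toMonoidHom :=
  (Subgroup.map_normalClosure S e.toMonoidHom e.surjective).symm

end Rewriting

/-- A homomorphism to `𝔽_p` is determined on a free basis, so the basis has at least `dim Hom(K,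
𝔽_p)` elements and Schreier's bound applies. -/
theorem exists_freeBasis_fin (p : ℕ) [Fact p.Prime] {n : ℕ} (K : Subgroup (FreeGroup (Fin n)))
    [K.FiniteIndex] :
    ∃ n' : ℕ, Nonempty (K ≃* FreeGroup (Fin n')) ∧ K.index * n + 1 ≤ n' + K.index := by
  have hfg : Group.FG K := Subgroup.fg_of_index_ne_zero K
  obtain ⟨ι, ⟨b⟩⟩ := IsFreeGroup.nonempty_basis (G := K)
  have hfin : Finite ι := by
    have : Group.FG (FreeGroup ι) := Group.fg_of_surjective (f := b.repr.toMonoidHom)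
      b.repr.surjective
    let Φ : (ι → ZMod p) →ₗ[ZMod p] ModPHom p (FreeGroup ι) :=
      { toFun := fun a => MonoidHom.toAdditiveLeft (FreeGroup.lift fun i => Multiplicative.ofAdd (a i))
        map_add' := fun a b => by
          apply MonoidHom.toAdditiveLeft.symm.injective
          ext i; simp
        map_smul' := fun r a => by
          apply MonoidHom.toAdditiveLeft.symm.injective
          ext i; simp }
    have hΦ : Function.Injective Φ := by
      intro a b h
      funext i
      have := DFunLike.congr_fun h (Additive.ofMul (FreeGroup.of i))
      simpa [Φ] using this
    have := FiniteDimensional.of_injective (Φ ∘ₗ Finsupp.lcoeFun)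
      (hΦ.comp (DFunLike.coe_injective : Function.Injective fun v : ι →₀ ZMod p => (v : ι → ZMod p)))
    exact Module.Finite.finite_basis (Finsupp.basisSingleOne (R := ZMod p) (ι := ι))
  have : Fintype ι := Fintype.ofFinite ι
  refine ⟨Fintype.card ι, ⟨(b.reindex (Fintype.equivFin ι)).repr⟩, ?_⟩
  refine (schreier_le_finrank p K).trans (Nat.add_le_add_right ?_ _)
  let Θ : ModPHom p K →ₗ[ZMod p] (ι → ZMod p) :=
    { toFun := fun f i => f (Additive.ofMul (b i))
      map_add' := fun _ _ => rfl
      map_smul' := fun _ _ => rfl }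
  have hΘ : Function.Injective Θ := by
    intro f g h
    apply AddMonoidHom.toMultiplicativeRight.injective
    exact b.ext_hom _ _ fun i => congrFun h i
  simpa using LinearMap.finrank_le_finrank_of_injective hΘ

theorem exists_presentation_subgroup (p : ℕ) [Fact p.Prime] {G : Type*} [Group G] {n : ℕ}
    {φ : FreeGroup (Fin n) →* G} (hφ : Function.Surjective φ)
    {R : Set (FreeGroup (Fin n))} (hRfin : R.Finite) (hR : Subgroup.normalClosure R = φ.ker)
    (H : Subgroup G) [H.FiniteIndex] :
    ∃ (n' : ℕ) (R' : Finset (FreeGroup (Fin n'))),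
      IsPresentationOf (R' : Set (FreeGroup (Fin n'))) H ∧
        (H.index : ℤ) * ((n : ℤ) - R.ncard - 1) + 1 ≤ deficiency R' := by
  classical
  let K := H.comap φ
  have hKi : K.index = H.index := Subgroup.index_comap_of_surjective H hφ
  have : K.FiniteIndex := ⟨hKi ▸ Subgroup.FiniteIndex.index_ne_zero⟩
  obtain ⟨n', ⟨e⟩, hn'⟩ := exists_freeBasis_fin p K
  have hRK : Subgroup.normalClosure R ≤ K := by
    rw [hR]
    intro x hx
    change φ x ∈ H
    rw [MonoidHom.mem_ker.1 hx]
    exact H.one_mem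
  obtain ⟨hfin, hcard⟩ := finite_rewrittenRelators hRfin K
  have hfin' : (e '' rewrittenRelators R K).Finite := hfin.image _
  refine ⟨n', hfin'.toFinset, ?_, ?_⟩
  · rw [Set.Finite.coe_toFinset]
    let ψ : FreeGroup (Fin n') →* H := (φ.subgroupComap H).comp e.symm.toMonoidHom
    have hψ : Function.Surjective ψ :=
      (MonoidHom.subgroupComap_surjective_of_surjective φ H hφ).comp e.symm.surjective
    have hker : Subgroup.normalClosure (e '' rewrittenRelators R K) = ψ.ker := by
      have h1 : Subgroup.normalClosure (e '' rewrittenRelators R K) =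
          (Subgroup.normalClosure (rewrittenRelators R K)).map e.toMonoidHom :=
        normalClosure_image_mulEquiv e _
      rw [h1, normalClosure_rewrittenRelators hRK, hR]
      ext x
      rw [Subgroup.mem_map_equiv, Subgroup.mem_subgroupOf, MonoidHom.mem_ker, MonoidHom.mem_ker,
        ← Subtype.coe_inj]
      rfl
    exact ⟨(QuotientGroup.quotientMulEquivOfEq hker).trans
      (QuotientGroup.quotientKerEquivOfSurjective ψ hψ)⟩
  -- Rewritten relators may coincide, which only raises the deficiency.
  · have h2 : hfin'.toFinset.card ≤ H.index * R.ncard := by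
      rw [← Set.ncard_eq_toFinset_card _ hfin',
        Set.ncard_image_of_injective _ e.injective, ← hKi]
      exact hcard
    rw [hKi] at hn'
    unfold deficiency
    zify at h2 hn'
    linarith

/-! ### Puchta's inequality: counting the conditions imposed by relators. -/

section PuchtaInequality

theorem relatorNu_eq_of_bounded {p n N : ℕ} (r : FreeGroup (Fin n))
    (h : ∀ k, (∃ w : FreeGroup (Fin n), w ^ p ^ k = r) → k ≤ N) :
    ∃ k : ℕ, relatorNu p r = (k : ℕ∞) ∧ ∃ w : FreeGroup (Fin n), w ^ p ^ k = r := by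
  have hne : {k | ∃ w : FreeGroup (Fin n), w ^ p ^ k = r}.Nonempty := ⟨0, r, by simp⟩
  have hbdd : BddAbove {k | ∃ w : FreeGroup (Fin n), w ^ p ^ k = r} := ⟨N, fun k hk => h k hk⟩
  refine ⟨sSup {k | ∃ w : FreeGroup (Fin n), w ^ p ^ k = r}, le_antisymm ?_ ?_,
    Nat.sSup_mem hne hbdd⟩
  · exact iSup₂_le fun k hk => Nat.cast_le.2 (le_csSup hbdd hk)
  · exact le_iSup₂_of_le (f := fun (k : ℕ) (_ : ∃ w : FreeGroup (Fin n), w ^ p ^ k = r) => (k : ℕ∞))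
      _ (Nat.sSup_mem hne hbdd) le_rfl

variable {F : Type*} [Group F]

/-- Evaluation at `t * r * t⁻¹`. -/
def conjEval (p : ℕ) (K : Subgroup F) [hK : K.Normal] (r : K) (t : F) :
    Module.Dual (ZMod p) (ModPHom p K) where
  toFun f := f (Additive.ofMul ⟨t * r.1 * t⁻¹, hK.conj_mem r.1 r.2 t⟩)
  map_add' _ _ := rfl
  map_smul' _ _ := rfl

variable {p : ℕ} {K : Subgroup F} [hK : K.Normal]

theorem conjEval_mul_mem (r : K) (t k : F) (hk : k ∈ K) :
    conjEval p K r (t * k) = conjEval p K r t := by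
  apply LinearMap.ext
  intro f
  have := f.map_conj ⟨t * k * t⁻¹, hK.conj_mem k hk t⟩ ⟨t * r.1 * t⁻¹, hK.conj_mem r.1 r.2 t⟩
  refine Eq.trans ?_ this
  refine congrArg (fun x : K => f (Additive.ofMul x)) (Subtype.ext ?_)
  simp only [Subgroup.coe_mul, Subgroup.coe_inv]
  group

theorem conjEval_mul_commute (r : K) (t w : F) (hw : Commute w r.1) :
    conjEval p K r (t * w) = conjEval p K r t := by
  apply LinearMap.ext
  intro f
  refine congrArg (fun x : K => f (Additive.ofMul x)) (Subtype.ext ?_)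
  change t * w * r.1 * (t * w)⁻¹ = t * r.1 * t⁻¹
  rw [mul_assoc t w, hw.eq]
  group

/-- If `r = w ^ p ^ k` is not killed in `𝔽_p`-homology, then `w` has order `p ^ k` modulo `K`. -/
theorem orderOf_eq_of_conjEval_ne_zero [Fact p.Prime] (r : K) {t w : F} {k : ℕ}
    (hw : w ^ p ^ k = r.1) (h : conjEval p K r t ≠ 0) : orderOf (w : F ⧸ K) = p ^ k := by
  have hdvd : orderOf (w : F ⧸ K) ∣ p ^ k := by
    rw [orderOf_dvd_iff_pow_eq_one, ← QuotientGroup.mk_pow, QuotientGroup.eq_one_iff, hw]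
    exact r.2
  obtain ⟨j, hj, hord⟩ := (Nat.dvd_prime_pow Fact.out).1 hdvd
  rcases hj.eq_or_lt with rfl | hlt
  · exact hord
  · exfalso
    apply h
    apply LinearMap.ext
    intro f
    -- If the order were `p ^ j` with `j < k`, then `r` would be a `p`-th power inside `K`, hence
    -- invisible to maps to `𝔽_p`.
    have hwj : w ^ p ^ j ∈ K := by
      rw [← QuotientGroup.eq_one_iff, QuotientGroup.mk_pow, ← hord, pow_orderOf_eq_one]
    have := f.map_pow' ⟨t * w ^ p ^ j * t⁻¹, hK.conj_mem _ hwj t⟩ (p ^ (k - j))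
    have h0 : p ^ (k - j) • f (Additive.ofMul ⟨t * w ^ p ^ j * t⁻¹, hK.conj_mem _ hwj t⟩) = 0 := by
      rw [nsmul_eq_mul, Nat.cast_pow, ZMod.natCast_self, zero_pow (by omega), zero_mul]
    rw [h0] at this
    refine Eq.trans ?_ this
    refine congrArg (fun x : K => f (Additive.ofMul x)) (Subtype.ext ?_)
    change t * r.1 * t⁻¹ = (t * w ^ p ^ j * t⁻¹) ^ p ^ (k - j)
    rw [conj_pow, ← pow_mul, ← pow_add, Nat.add_sub_cancel' hlt.le, hw]

/-- The functional depends on `t` only through its coset of `⟨w⟩` in `F ⧸ K`, and there are `K.index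
/ orderOf w` such cosets. -/
theorem ncard_range_conjEval_mul_le (r : K) {w : F} [K.FiniteIndex] (hw : Commute w r.1) :
    (Set.range (conjEval p K r)).Finite ∧
      (Set.range (conjEval p K r)).ncard * orderOf (w : F ⧸ K) ≤ K.index := by
  let Q := (F ⧸ K) ⧸ Subgroup.zpowers (w : F ⧸ K)
  have : Finite (F ⧸ K) := Subgroup.finite_quotient_of_finiteIndex
  have hsub : Set.range (conjEval p K r) ⊆
      Set.range fun q : Q => conjEval p K r q.out.out := by
    rintro _ ⟨t, rfl⟩
    refine ⟨((t : F ⧸ K) : Q), ?_⟩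
    set x : F ⧸ K := (((t : F ⧸ K) : Q)).out
    have h1 : (x : Q) = ((t : F ⧸ K) : Q) := QuotientGroup.out_eq' _
    rw [QuotientGroup.eq] at h1
    obtain ⟨i, hi⟩ := h1
    have hx : ((x.out : F) : F ⧸ K) = x := QuotientGroup.out_eq' _
    have h2 : ((x.out * w ^ i : F) : F ⧸ K) = (t : F ⧸ K) := by
      rw [QuotientGroup.mk_mul, hx, QuotientGroup.mk_zpow]
      simp only at hi
      rw [hi]; simp
    rw [QuotientGroup.eq] at h2
    have h3 : t = x.out * w ^ i * ((x.out * w ^ i)⁻¹ * t) := by group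
    change conjEval p K r x.out = _
    rw [h3, conjEval_mul_mem _ _ _ h2, conjEval_mul_commute _ _ _ (hw.zpow_left i)]
  have hfin := Set.finite_range fun q : Q => conjEval p K r q.out.out
  refine ⟨hfin.subset hsub, ?_⟩
  calc (Set.range (conjEval p K r)).ncard * orderOf (w : F ⧸ K)
      ≤ Nat.card Q * orderOf (w : F ⧸ K) := by
        refine Nat.mul_le_mul_right _ ((Set.ncard_le_ncard hsub hfin).trans ?_)
        rw [← Set.image_univ, ← Set.ncard_univ]
        exact Set.ncard_image_le Set.finite_univ
    _ = K.index := by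
        rw [← Nat.card_zpowers, Subgroup.index_eq_card]
        exact (Subgroup.card_eq_card_quotient_mul_card_subgroup _).symm

/-- The functionals given by the conjugates of a relator number at most the index times the
weight of the relator, unless they all vanish. -/
theorem ncard_conjEval_le_weight [Fact p.Prime] {n N : ℕ} {K : Subgroup (FreeGroup (Fin n))}
    [K.Normal] (hN : K.index = p ^ N) (r : K) {t : FreeGroup (Fin n)}
    (h : conjEval p K r t ≠ 0) :
    (Set.range (conjEval p K r)).Finite ∧
      ((Set.range (conjEval p K r)).ncard : ℝ≥0∞) ≤ p ^ N * relatorWeight p r.1 ∧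
        ((p : ℝ≥0∞) ^ N)⁻¹ ≤ relatorWeight p r.1 := by
  have hp : p.Prime := Fact.out
  have hfi : K.FiniteIndex := ⟨by rw [hN]; exact pow_ne_zero _ hp.ne_zero⟩
  -- The order `p ^ k` divides `|F ⧸ K| = p ^ N`. This bounds `k`, so `relatorNu` is finite and
  -- attained.
  have key (k : ℕ) (w : FreeGroup (Fin n)) (hw : w ^ p ^ k = r.1) : k ≤ N := by
    have h1 := orderOf_eq_of_conjEval_ne_zero r hw h
    have h2 : orderOf (w : FreeGroup (Fin n) ⧸ K) ∣ p ^ N := by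
      rw [← hN, Subgroup.index_eq_card]; exact orderOf_dvd_natCard _
    rw [h1] at h2
    exact (Nat.pow_dvd_pow_iff_le_right hp.one_lt).1 h2
  obtain ⟨k, hk, w, hw⟩ := relatorNu_eq_of_bounded r.1 fun k ⟨w, hw⟩ => key k w hw
  have hwt : relatorWeight p r.1 = ((p : ℝ≥0∞) ^ k)⁻¹ := by
    simp [relatorWeight, hk]
  have hcomm : Commute w r.1 := by rw [← hw]; exact (Commute.refl w).pow_right _
  obtain ⟨hfin, hle⟩ := ncard_range_conjEval_mul_le (p := p) r hcomm
  rw [orderOf_eq_of_conjEval_ne_zero r hw h, hN] at hle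
  have hp0 : (p : ℝ≥0∞) ≠ 0 := by exact_mod_cast hp.ne_zero
  refine ⟨hfin, ?_, ?_⟩
  · rw [hwt, ← div_eq_mul_inv, ENNReal.le_div_iff_mul_le (Or.inl (pow_ne_zero _ hp0))
      (Or.inl (by simp))]
    exact_mod_cast hle
  · rw [hwt, ENNReal.inv_le_inv]
    exact pow_le_pow_right₀ (by exact_mod_cast hp.one_lt.le) (key k w hw)

end PuchtaInequality

/-- A homomorphism on `K` killed by every functional in `E` vanishes on all conjugates of relators,
hence on `φ.ker`, and descends to `H`. At most `E.card` linear conditions are imposed. -/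
theorem finrank_modPHom_le_add_card {p : ℕ} [Fact p.Prime] {F G : Type*} [Group F] [Group G]
    {φ : F →* G} (hφ : Function.Surjective φ) {R : Set F}
    (hR : Subgroup.normalClosure R = φ.ker) {H : Subgroup G} {K : Subgroup F}
    (hK : K = H.comap φ) [K.Normal] [Group.FG K] [Group.FG H]
    (E : Finset (Module.Dual (ZMod p) (ModPHom p K)))
    (hE : ∀ (r : K) (t : F), r.1 ∈ R → conjEval p K r t ≠ 0 → conjEval p K r t ∈ E) :
    Module.finrank (ZMod p) (ModPHom p K) ≤ Module.finrank (ZMod p) (ModPHom p H) + E.card := by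
  subst hK
  let Φ : ModPHom p (H.comap φ) →ₗ[ZMod p] (E → ZMod p) := LinearMap.pi fun e => e.1
  let ρ : ModPHom p H →ₗ[ZMod p] ModPHom p (H.comap φ) :=
    { toFun := fun f => f.comp (φ.subgroupComap H).toAdditive
      map_add' := fun _ _ => rfl
      map_smul' := fun _ _ => rfl }
  have hker : LinearMap.ker Φ ≤ LinearMap.range ρ := by
    intro f hf
    have hfE (e) (he : e ∈ E) : e f = 0 := congrFun (LinearMap.mem_ker.1 hf) ⟨e, he⟩
    have hle : Subgroup.normalClosure R ≤ f.kernel.map (H.comap φ).subtype := by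
      rw [Subgroup.normalClosure, Subgroup.closure_le]
      intro x hx
      rw [Group.mem_conjugatesOfSet_iff] at hx
      obtain ⟨r, hr, hx⟩ := hx
      obtain ⟨t, rfl⟩ := isConj_iff.1 hx
      have hrK : r ∈ H.comap φ := by
        have : r ∈ φ.ker := hR ▸ Subgroup.subset_normalClosure hr
        rw [Subgroup.mem_comap, MonoidHom.mem_ker.1 this]
        exact H.one_mem
      refine ⟨⟨t * r * t⁻¹, Subgroup.Normal.conj_mem inferInstance r hrK t⟩, ?_, rfl⟩
      change conjEval p (H.comap φ) ⟨r, hrK⟩ t f = 0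
      by_cases h0 : conjEval p (H.comap φ) ⟨r, hrK⟩ t = 0
      · rw [h0]; rfl
      · exact hfE _ (hE _ _ hr h0)
    have hsurj : Function.Surjective (φ.subgroupComap H).toAdditive :=
      MonoidHom.subgroupComap_surjective_of_surjective φ H hφ
    have hkerle : (φ.subgroupComap H).toAdditive.ker ≤ f.ker := by
      intro k hk
      have hk1 : (Additive.toMul k).1 ∈ φ.ker := congrArg Subtype.val hk
      rw [← hR] at hk1
      obtain ⟨k', hk', h'⟩ := hle hk1
      have h2 : k' = Additive.toMul k := Subtype.ext h'
      subst h2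
      exact hk'
    refine ⟨(φ.subgroupComap H).toAdditive.liftOfSurjective hsurj ⟨f, hkerle⟩, ?_⟩
    exact AddMonoidHom.liftOfRightInverse_comp _ _ _ ⟨f, hkerle⟩
  have h1 := LinearMap.finrank_range_add_finrank_ker Φ
  have h2 : Module.finrank (ZMod p) (LinearMap.range Φ) ≤ E.card := by
    refine (Submodule.finrank_le _).trans ?_
    simp
  have h3 := (Submodule.finrank_mono hker).trans (LinearMap.finrank_range_le ρ)
  omega

/-- The growth of the `p`-rank in normal subgroups of `p`-power index. -/
theorem finrank_modPHom_ge {p : ℕ} [Fact p.Prime] {G : Type*} [Group G] {n N : ℕ}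
    {φ : FreeGroup (Fin n) →* G} (hφ : Function.Surjective φ) {R : Set (FreeGroup (Fin n))}
    (hR : Subgroup.normalClosure R = φ.ker)
    (hS : ∑' r : R, relatorWeight p r.1 ≠ ⊤) (H : Subgroup G) [H.Normal] [Group.FG H]
    (hN : H.index = p ^ N) :
    (p : ℝ) ^ N * (n - (∑' r : R, relatorWeight p r.1).toReal - 1) + 1 ≤
      Module.finrank (ZMod p) (ModPHom p H) := by
  classical
  have hp : p.Prime := Fact.out
  obtain ⟨K, hK⟩ : ∃ K, K = H.comap φ := ⟨_, rfl⟩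
  have hKi : K.index = p ^ N := by
    rw [hK, ← hN]; exact Subgroup.index_comap_of_surjective H hφ
  have hKn : K.Normal := hK ▸ inferInstance
  have : K.FiniteIndex := ⟨by rw [hKi]; exact pow_ne_zero _ hp.ne_zero⟩
  have hfg : Group.FG K := Subgroup.fg_of_index_ne_zero K
  have hRK (r : R) : r.1 ∈ K := by
    have : r.1 ∈ φ.ker := hR ▸ Subgroup.subset_normalClosure r.2
    rw [hK, Subgroup.mem_comap, MonoidHom.mem_ker.1 this]
    exact H.one_mem
  let B : Set R := {r | ∃ t, conjEval p K ⟨r.1, hRK r⟩ t ≠ 0}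
  have hB (r) (hr : r ∈ B) := ncard_conjEval_le_weight hKi ⟨r.1, hRK r⟩ hr.choose_spec
  -- Each contributing relator has weight at least `p ^ (-N)`, so convergence of the sum leaves only
  -- finitely many, even when `R` is infinite.
  have hBfin : B.Finite := by
    refine (ENNReal.finite_const_le_of_tsum_ne_top hS
      (ε := ((p : ℝ≥0∞) ^ N)⁻¹) (by simp)).subset ?_
    intro r hr
    exact (hB r hr).2.2
  let E : Finset (Module.Dual (ZMod p) (ModPHom p K)) :=
    hBfin.toFinset.attach.biUnion fun r =>
      (hB r.1 (hBfin.mem_toFinset.1 r.2)).1.toFinset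
  have hE : (E.card : ℝ≥0∞) ≤ p ^ N * ∑' r : R, relatorWeight p r.1 := by
    calc (E.card : ℝ≥0∞)
        ≤ ∑ r ∈ hBfin.toFinset.attach, (p : ℝ≥0∞) ^ N * relatorWeight p r.1.1 := by
          refine (Nat.cast_le.2 Finset.card_biUnion_le).trans ?_
          rw [Nat.cast_sum]
          refine Finset.sum_le_sum fun r _ => ?_
          rw [← Set.ncard_eq_toFinset_card _ (hB r.1 (hBfin.mem_toFinset.1 r.2)).1]
          exact (hB r.1 (hBfin.mem_toFinset.1 r.2)).2.1
      _ = ∑ r ∈ hBfin.toFinset, (p : ℝ≥0∞) ^ N * relatorWeight p r.1 :=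
          Finset.sum_attach _ fun r : R => (p : ℝ≥0∞) ^ N * relatorWeight p r.1
      _ ≤ _ := by
          rw [← Finset.mul_sum]
          gcongr
          exact ENNReal.sum_le_tsum _
  have hE' : (E.card : ℝ) ≤ p ^ N * (∑' r : R, relatorWeight p r.1).toReal := by
    have := ENNReal.toReal_mono (ENNReal.mul_ne_top (by simp) hS) hE
    simpa using this
  have h1 := finrank_modPHom_le_add_card hφ hR hK E (by
    intro r t hr h0
    refine Finset.mem_biUnion.2 ⟨⟨⟨r.1, hr⟩, hBfin.mem_toFinset.2 ⟨t, h0⟩⟩,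
      Finset.mem_attach _ _, ?_⟩
    rw [Set.Finite.mem_toFinset]
    exact ⟨t, rfl⟩)
  have h2 := schreier_le_finrank p K
  rw [hKi] at h2
  have h3 : ((p ^ N * n + 1 : ℕ) : ℝ) ≤
      ((Module.finrank (ZMod p) (ModPHom p H) + E.card + p ^ N : ℕ) : ℝ) := by
    exact_mod_cast h2.trans (Nat.add_le_add_right h1 _)
  push_cast at h3
  linarith

/-! ### Comparison with `H₁(H; 𝔽_p)`. -/

section HomologyRank

open scoped TensorProduct

theorem exists_tensor_functional {p : ℕ} {M A : Type*} [AddCommGroup M] [AddCommGroup A]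
    (i : ZMod p ≃+ A) (f : M →+ ZMod p) :
    ∃ g : M ⊗[ℤ] A →+ ZMod p, ∀ m, g (m ⊗ₜ i 1) = f m := by
  refine ⟨(TensorProduct.lift ((LinearMap.mul ℤ (ZMod p)).compl₁₂ f.toIntLinearMap
    i.symm.toAddMonoidHom.toIntLinearMap)).toAddMonoidHom, fun m => ?_⟩
  simp

/-- The identification `e` is only additive, so dimensions are compared by counting elements of
finite spaces; an injection of sets suffices. -/
theorem finrank_modPHom_le_of_addEquiv {p : ℕ} [Fact p.Prime] {H : Type*} [Group H] [Group.FG H]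
    {k V A : Type*} [Field k] [AddCommGroup V] [Module k V] [AddCommGroup A] (j : ZMod p ≃+* k)
    (i : ZMod p ≃+ A) (e : V ≃+ Additive (Abelianization H) ⊗[ℤ] A) :
    Module.finrank (ZMod p) (ModPHom p H) ≤ Module.finrank k V := by
  have hp : p.Prime := Fact.out
  have hA : Module.Finite ℤ A := by
    have : Finite A := Finite.of_equiv _ i.toEquiv
    infer_instance
  have hkf : Finite k := Finite.of_equiv _ j.toEquiv
  have hab : Module.Finite ℤ (Additive (Abelianization H)) := by
    have : Group.FG (Abelianization H) :=
      Group.fg_of_surjective (f := Abelianization.of) (QuotientGroup.mk'_surjective _)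
    infer_instance
  have hT : Module.Finite ℤ (Additive (Abelianization H) ⊗[ℤ] A) :=
    Module.Finite.tensorProduct ℤ _ _
  have hVZ : Module.Finite ℤ V := Module.Finite.equiv e.symm.toIntLinearEquiv
  have hV : Module.Finite k V := Module.Finite.of_restrictScalars_finite ℤ k V
  let fab (f : ModPHom p H) : Additive (Abelianization H) →+ ZMod p :=
    (Abelianization.lift (AddMonoidHom.toMultiplicativeRight f)).toAdditiveLeft
  choose g hg using fun f => exists_tensor_functional i (fab f)
  let Ψ (f : ModPHom p H) : Module.Dual k V :=
    { toFun := fun v => j (g f (e v))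
      map_add' := fun v w => by simp
      -- Every scalar of `k` is the image of a natural number, so additivity gives linearity.
      map_smul' := fun c v => by
        obtain ⟨a, rfl⟩ := j.surjective c
        obtain ⟨n, rfl⟩ := ZMod.natCast_zmod_surjective a
        simp [Nat.cast_smul_eq_nsmul] }
  have hΨ : Function.Injective Ψ := by
    intro f f' h
    apply DFunLike.ext
    intro x
    have h1 := LinearMap.congr_fun h
      (e.symm (Additive.ofMul (Abelianization.of x.toMul) ⊗ₜ i 1))
    simp only [Ψ, LinearMap.coe_mk, AddHom.coe_mk, AddEquiv.apply_symm_apply, hg] at h1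
    exact j.injective h1
  have hfinD : Finite (Module.Dual k V) := Module.finite_of_finite k
  have hcard := Nat.card_le_card_of_injective Ψ hΨ
  rw [Module.natCard_eq_pow_finrank (K := ZMod p) (V := ModPHom p H),
    Module.natCard_eq_pow_finrank (K := k) (V := Module.Dual k V),
    ← Nat.card_congr j.toEquiv, Subspace.dual_finrank_eq, Nat.card_zmod] at hcard
  exact (Nat.pow_le_pow_iff_right hp.one_lt).1 hcard

theorem finrank_modPHom_le_pRank.{u} (p : ℕ) [Fact p.Prime] (H : Type u) [Group H] [Group.FG H] :
    Module.finrank (ZMod p) (ModPHom p H) ≤ pRank p H :=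
  finrank_modPHom_le_of_addEquiv (k := ULift.{u} (ZMod p)) ULift.ringEquiv.symm
    AddEquiv.ulift.symm (groupHomology.H1AddEquivOfIsTrivial
      (Rep.trivial (ULift.{u} (ZMod p)) H (ULift.{u} (ZMod p))))

end HomologyRank

/-! ### Normal subgroups of large `p`-power index. -/

section PowerIndexSubgroups

/-- The intersection of the kernels of all homomorphisms `H → 𝔽_p`, as a subgroup of `G`. -/
def modPFrattini (p : ℕ) {G : Type*} [Group G] (H : Subgroup G) : Subgroup G :=
  (⨅ f : ModPHom p H, f.kernel).map H.subtype

variable {p : ℕ} {G : Type*} [Group G]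

theorem mem_modPFrattini {H : Subgroup G} {g : G} :
    g ∈ modPFrattini p H ↔ ∃ h : g ∈ H, ∀ f : ModPHom p H, f (Additive.ofMul ⟨g, h⟩) = 0 := by
  constructor
  · rintro ⟨x, hx, rfl⟩
    exact ⟨x.2, fun f => (Subgroup.mem_iInf.1 hx) f⟩
  · rintro ⟨h, hf⟩
    exact ⟨⟨g, h⟩, Subgroup.mem_iInf.2 hf, rfl⟩

theorem normal_modPFrattini (H : Subgroup G) [hH : H.Normal] : (modPFrattini p H).Normal := by
  refine ⟨fun x hx g => ?_⟩
  rw [mem_modPFrattini] at hx ⊢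
  obtain ⟨hxH, hf⟩ := hx
  refine ⟨hH.conj_mem x hxH g, fun f => ?_⟩
  exact hf (f.comp (MulAut.conjNormal g : MulAut H).toMonoidHom.toAdditive)

/-- The quotient of `H` by the common kernel is a finite group of exponent dividing `p`, nontrivial
because some map to `𝔽_p` is nonzero. -/
theorem exists_index_modPFrattini [Fact p.Prime] (H : Subgroup G) [Group.FG H] {N : ℕ} (hN : H.index = p ^ N)
    (hpos : 0 < Module.finrank (ZMod p) (ModPHom p H)) :
    ∃ N', N < N' ∧ (modPFrattini p H).index = p ^ N' := by
  have hp : p.Prime := Fact.out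
  let L : Subgroup H := ⨅ f : ModPHom p H, f.kernel
  have hfin : Finite (ModPHom p H) := Module.finite_of_finite (ZMod p)
  have hle : modPFrattini p H ≤ H := Subgroup.map_subtype_le _
  have hrel : (modPFrattini p H).relIndex H = L.index := by
    rw [Subgroup.relIndex, Subgroup.subgroupOf, modPFrattini,
      Subgroup.comap_map_eq_self_of_injective H.subtype_injective]
  have hmem (x : H) : x ∈ L ↔ ∀ f : ModPHom p H, f (Additive.ofMul x) = 0 := Subgroup.mem_iInf
  have hLn : L.Normal := ⟨fun x hx g => (hmem _).2 fun f => by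
    rw [ModPHom.map_conj]; exact (hmem x).1 hx f⟩
  have hpg : IsPGroup p (H ⧸ L) := by
    intro x
    obtain ⟨h, rfl⟩ := QuotientGroup.mk_surjective x
    refine ⟨1, ?_⟩
    rw [pow_one, ← QuotientGroup.mk_pow, QuotientGroup.eq_one_iff, hmem]
    intro f
    rw [ModPHom.map_pow']
    simp
  have hLfin : Finite (H ⧸ L) := by
    let Φ : H ⧸ L → (ModPHom p H → ZMod p) := fun q f => f (Additive.ofMul q.out)
    refine Finite.of_injective Φ fun q q' h => ?_
    rw [← QuotientGroup.out_eq' q, ← QuotientGroup.out_eq' q', QuotientGroup.eq, hmem]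
    intro f
    rw [ModPHom.map_mul', ModPHom.map_inv', neg_add_eq_zero]
    exact congrFun h f
  obtain ⟨j, hj⟩ := IsPGroup.iff_card.1 hpg
  rw [← Subgroup.index_eq_card] at hj
  have hj0 : j ≠ 0 := by
    rintro rfl
    rw [pow_zero, Subgroup.index_eq_one] at hj
    obtain ⟨f, hf⟩ := Module.finrank_pos_iff_exists_ne_zero.1 hpos
    refine hf (DFunLike.ext _ _ fun x => ?_)
    exact (hmem x.toMul).1 (hj ▸ Subgroup.mem_top _) f
  refine ⟨N + j, by omega, ?_⟩
  rw [← Subgroup.relIndex_mul_index hle, hrel, hj, hN, pow_add, mul_comm]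

/-- If normal subgroups of `p`-power index always have a nontrivial map to `𝔽_p`, then there are
such subgroups of arbitrarily large index. -/
theorem exists_normal_index_pow_ge [Fact p.Prime] [Group.FG G]
    (h : ∀ (H : Subgroup G) [H.Normal] [Group.FG H] (N : ℕ), H.index = p ^ N →
      0 < Module.finrank (ZMod p) (ModPHom p H)) (M : ℕ) :
    ∃ (H : Subgroup G) (N : ℕ), M ≤ N ∧ H.Normal ∧ H.index = p ^ N := by
  have hp : p.Prime := Fact.out
  induction M with
  | zero => exact ⟨⊤, 0, le_rfl, inferInstance, by simp⟩
  | succ M ih =>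
    obtain ⟨H, N, hMN, hH, hN⟩ := ih
    have : H.FiniteIndex := ⟨by rw [hN]; exact pow_ne_zero _ hp.ne_zero⟩
    have hfg : Group.FG H := Subgroup.fg_of_index_ne_zero H
    obtain ⟨N', hlt, hN'⟩ := exists_index_modPFrattini H hN (h H N hN)
    exact ⟨modPFrattini p H, N', by omega, normal_modPFrattini H, hN'⟩

end PowerIndexSubgroups

/-! ### Assembly of the two estimates. -/

theorem exists_hom_of_isPresentationOf {G : Type*} [Group G] {n : ℕ}
    {R : Set (FreeGroup (Fin n))} (h : IsPresentationOf R G) :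
    ∃ φ : FreeGroup (Fin n) →* G, Function.Surjective φ ∧ Subgroup.normalClosure R = φ.ker := by
  obtain ⟨e⟩ := h
  refine ⟨e.toMonoidHom.comp (PresentedGroup.mk R),
    e.surjective.comp (PresentedGroup.mk_surjective R), ?_⟩
  ext x
  change _ ↔ e (PresentedGroup.mk R x) = 1
  rw [EmbeddingLike.map_eq_one_iff]
  exact PresentedGroup.mk_eq_one_iff.symm

theorem tsum_weight_of_one_lt_pDeficiency {p n : ℕ} {R : Set (FreeGroup (Fin n))}
    (h : 1 < pDeficiency p R) :
    ∑' r : R, relatorWeight p r.1 ≠ ⊤ ∧ 0 < n - (∑' r : R, relatorWeight p r.1).toReal - 1 := by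
  unfold pDeficiency at h
  generalize (∑' r : R, relatorWeight p r.1) = S at h
  have hS : S ≠ ⊤ := by
    rintro rfl
    simp [EReal.sub_top] at h
  refine ⟨hS, ?_⟩
  lift S to NNReal using hS
  have h' : ((1 : ℝ) : EReal) < (((n : ℝ) - (S : ℝ) : ℝ) : EReal) := by
    rw [EReal.coe_sub]
    exact h
  have := EReal.coe_lt_coe_iff.1 h'
  simp only [ENNReal.coe_toReal]
  linarith

/-- Since `d ^ 2 / 4 - d` increases for `d ≥ 2`, `d` may be replaced by `m * ε + 1`; what remains is
`m * (m * ε ^ 2 - 2 * ε - 4 * C) / 4 + 1 / 4`. -/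
theorem golodShafarevich_of_growth {ε C m d D : ℝ} (hm : 0 ≤ m)
    (h1 : 4 * C + 2 * ε < m * ε ^ 2) (h2 : 1 ≤ m * ε) (hd : m * ε + 1 ≤ d)
    (hD : 1 - m * C ≤ D) : 0 < D + d ^ 2 / 4 - d := by
  have h3 : 0 ≤ (d - (m * ε + 1)) * (d + (m * ε + 1) - 4) :=
    mul_nonneg (by linarith) (by linarith)
  have hm0 : 0 < m := by
    rcases hm.eq_or_lt with rfl | h
    · linarith
    · exact h
  have h4 : 0 < m * (m * ε ^ 2 - (4 * C + 2 * ε)) := mul_pos hm0 (by linarith)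
  nlinarith

theorem mainTheorem7 (p : ℕ) (hp : p.Prime) (G : Type*) [Group G]
    (hfp : Group.IsFinitelyPresented G) (hG : IsPuchtaGroup p G) :
    ∃ (H : Subgroup G) (N : ℕ), 1 ≤ N ∧ H.Normal ∧ H.index = p ^ N ∧
      IsStronglyGolodShafarevich p H := by
  have : Fact p.Prime := ⟨hp⟩
  obtain ⟨n, R, hpres, hdef⟩ := hG
  obtain ⟨φ, hφ, hR⟩ := exists_hom_of_isPresentationOf hpres
  obtain ⟨hS, hε⟩ := tsum_weight_of_one_lt_pDeficiency hdef
  -- This finite presentation need not be related to the Puchta one: it controls the deficiency, the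
  -- other the rank.
  obtain ⟨n₂, φ₂, hφ₂, R₂, hR₂fin, hR₂⟩ := hfp.out
  have hfg : Group.FG G := Group.fg_of_surjective hφ
  set ε : ℝ := n - (∑' r : R, relatorWeight p r.1).toReal - 1 with hεdef
  have growth (H : Subgroup G) [H.Normal] [Group.FG H] (N : ℕ) (hN : H.index = p ^ N) :
      (p : ℝ) ^ N * ε + 1 ≤ Module.finrank (ZMod p) (ModPHom p H) :=
    finrank_modPHom_ge hφ hR hS H hN
  have hpos (N : ℕ) : (0 : ℝ) < (p : ℝ) ^ N := pow_pos (by exact_mod_cast hp.pos) N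
  set C : ℝ := -((n₂ : ℝ) - R₂.ncard - 1) with hC
  have htend := tendsto_pow_atTop_atTop_of_one_lt
    (show (1 : ℝ) < p by exact_mod_cast hp.one_lt)
  obtain ⟨M, hM⟩ := Filter.eventually_atTop.1
    (htend.eventually_gt_atTop (max ((4 * C + 2 * ε) / ε ^ 2) (1 / ε)))
  -- The maximum with `1` secures `1 ≤ N`.
  obtain ⟨H, N, hMN, hH, hN⟩ := exists_normal_index_pow_ge (p := p) (G := G) (by
    intro H _ _ N hN
    have h1 := growth H N hN
    have h2 := mul_pos (hpos N) hε
    exact_mod_cast (by linarith : (0 : ℝ) < Module.finrank (ZMod p) (ModPHom p H))) (max M 1)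
  have hfi : H.FiniteIndex := ⟨by rw [hN]; exact pow_ne_zero _ hp.ne_zero⟩
  have hHfg : Group.FG H := Subgroup.fg_of_index_ne_zero H
  have hbig := hM N ((le_max_left _ _).trans hMN)
  have hb1 : 4 * C + 2 * ε < (p : ℝ) ^ N * ε ^ 2 :=
    (div_lt_iff₀ (by positivity)).1 ((le_max_left _ _).trans_lt hbig)
  have hb2 : 1 < (p : ℝ) ^ N * ε := (div_lt_iff₀ hε).1 ((le_max_right _ _).trans_lt hbig)
  have hd : (p : ℝ) ^ N * ε + 1 ≤ pRank p H :=
    (growth H N hN).trans (Nat.cast_le.2 (finrank_modPHom_le_pRank p H))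
  obtain ⟨n', R', hR', hdef'⟩ := exists_presentation_subgroup p hφ₂ hR₂fin hR₂ H
  refine ⟨H, N, (le_max_right _ _).trans hMN, hH, hN, ?_, n', R', hR', ?_⟩
  · have : (2 : ℝ) < pRank p H := by linarith
    exact_mod_cast this.le
  · refine golodShafarevich_of_growth (hpos N).le hb1 hb2.le hd ?_
    have : (((H.index : ℤ) * ((n₂ : ℤ) - R₂.ncard - 1) + 1 : ℤ) : ℝ) ≤ (deficiency R' : ℝ) :=
      Int.cast_le.2 hdef'
    rw [hN] at this
    push_cast at this
    linarith
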